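/- **Conventions.** Let $\mathbb K$ be any field. For a vector configuration $A=\{\mathbf a_1,\dots,\mathbf a_m\}\subset\mathbb Z^N$, the toric ideal $I_A\subset \mathbb K[x_1,\dots,x_m]$ is the ideal generated by all binomials $\mathbf x^{\mathbf u}-\mathbf x^{\mathbf v}$ with $\sum_i u_i\mathbf a_i=\sum_i v_i\mathbf a_i$. An irreducible binomial $\mathbf x^{\mathbf u}-\mathbf x^{\mathbf v}\in I_A$ is *primitive* if there is no other (nonzero) binomial $\mathbf x^{\mathbf w}-\mathbf x^{\mathbf z}\in I_A$ such that $\mathbf x^{\mathbf w}$ divides $\mathbf x^{\mathbf u}$ and $\mathbf x^{\mathbf z}$ divides $\mathbf x^{\mathbf v}$; the *Graver basis* $Gr_A$ is the set of all primitive binomials. For a finite simple graph $G$, put $a_e=v_i+v_j$ for each edge $e=\{v_i,v_j\}$, in the free abelian group on the vertices; $I_G\subset\mathbb K[e\mid e\in E(G)]$ and $Gr_G$ are the toric ideal and the Graver basis of the configuration $(a_e)_{e\in E(G)}$. For an even closed walk $w=(e_{1},e_{2},\dots,e_{2q})$ in $G$, where $e_i$ denotes the $i$-th edge of $w$, put $B_w=\prod_{j=1}^{q}e_{2j-1}-\prod_{j=1}^{q}e_{2j}$.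 For odd $n\ge 3$ let $G_0^n$ be a cycle of length $n$, and for $r\ge 0$ let $G_{r+1}^n$ be obtained from $G_r^n$ by adding, at each vertex $v$ of degree two of $G_r^n$, a new cycle of length $n$, one of whose vertices is identified with $v$ (the added cycles being otherwise disjoint from $G_r^n$ and from each other). For $k\ge 2$ the $k$-subdivision $S_k(G)$ of a graph $G$ is obtained by replacing every edge of $G$ by a path of $k$ new edges, through $k-1$ new vertices. **Proposition 3.8.** Let $n\ge 3$ be odd, $r\ge 1$, and $k\ge 3$ odd. Then every closed Eulerian trail $w$ of $S_k(G_r^n)$ (a closed walk that uses every edge exactly once) has even length, and its binomial $B_w$ belongs to the Graver basis $Gr_{S_k(G_r^n)}$ of the toric ideal $I_{S_k(G_r^n)}$. -/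

import Mathlib

noncomputable section

/-! ### Toric ideals and Graver bases -/

/-- The toric ideal of a vector configuration `a : σ → M` (with values in a commutative monoid such
as `ℤⁿ`): the ideal of `K[x_i | i ∈ σ]` generated by all binomials `x^u - x^v` such that the
`A`-degrees `∑ u_i a_i` and `∑ v_i a_i` agree. -/
def toricIdeal (K : Type*) [Field K] {σ M : Type*} [AddCommMonoid M] (a : σ → M) :
    Ideal (MvPolynomial σ K) :=
  Ideal.span {f | ∃ u v : σ →₀ ℕ,
    Finsupp.linearCombination ℕ a u = Finsupp.linearCombination ℕ a v ∧
      f = MvPolynomial.monomial u 1 - MvPolynomial.monomial v 1}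

/-- The Graver basis of the toric ideal of `a`: the set of its primitive binomials. An irreducible
binomial `x^u - x^v` of the toric ideal is primitive if there is no other (nonzero) binomial
`x^w - x^z` in the toric ideal such that `x^w` divides `x^u` and `x^z` divides `x^v`. -/
def graverBasis (K : Type*) [Field K] {σ M : Type*} [AddCommMonoid M] (a : σ → M) :
    Set (MvPolynomial σ K) :=
  {f | ∃ u v : σ →₀ ℕ,
    f = MvPolynomial.monomial u 1 - MvPolynomial.monomial v 1 ∧
    Irreducible f ∧ f ∈ toricIdeal K a ∧
    ¬ ∃ w z : σ →₀ ℕ, w ≠ z ∧ (w, z) ≠ (u, v) ∧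
      (MvPolynomial.monomial w 1 - MvPolynomial.monomial z 1 : MvPolynomial σ K)
        ∈ toricIdeal K a ∧
      (MvPolynomial.monomial w 1 : MvPolynomial σ K) ∣ MvPolynomial.monomial u 1 ∧
      (MvPolynomial.monomial z 1 : MvPolynomial σ K) ∣ MvPolynomial.monomial v 1}

/-- The vector `a_e = v_i + v_j` of an edge `e = {v_i, v_j}`, in the free abelian group on the
vertices. The toric ideal of the graph `G` is the toric ideal of this configuration. -/
def edgeVector {V : Type*} (G : SimpleGraph V) (e : G.edgeSet) : V →₀ ℤ :=
  Sym2.lift ⟨fun x y => Finsupp.single x 1 + Finsupp.single y 1, fun _ _ => add_comm _ _⟩ e.1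

/-- The sequence of edges `(e_1, …, e_s)` of a walk, each as an edge of the graph. -/
def walkEdges {V : Type*} {G : SimpleGraph V} {x y : V} (w : G.Walk x y) : List G.edgeSet :=
  w.darts.map fun d => ⟨d.edge, d.edge_mem⟩

/-- The binomial `B_w = e_1 e_3 e_5 ⋯ - e_2 e_4 e_6 ⋯` of a walk `w = (e_1, …, e_s)` (it is only
meaningful for even closed walks). List positions start at `0`, so `e_1, e_3, …` sit at the even
positions. -/
def walkBinomial (K : Type*) [Field K] {V : Type*} {G : SimpleGraph V} {x y : V}
    (w : G.Walk x y) : MvPolynomial G.edgeSet K :=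
  (∏ i : Fin (walkEdges w).length,
      if Even (i : ℕ) then MvPolynomial.X ((walkEdges w).get i) else 1) -
    ∏ i : Fin (walkEdges w).length,
      if Odd (i : ℕ) then MvPolynomial.X ((walkEdges w).get i) else 1

/-! ### The graphs `G_r^n` -/

/-- Vertices after adding a cycle of length `n` to every vertex of degree two of `G`: the old
vertices, and for each vertex of degree two the vertices of a copy of the cycle other than its
vertex `0`. -/
abbrev AddCyclesVertex {V : Type*} (G : SimpleGraph V) (n : ℕ) : Type _ :=
  V ⊕ ({v : V // (G.neighborSet v).ncard = 2} × {i : Fin n // (i : ℕ) ≠ 0})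

/-- The copy of the cycle of length `n` that is added at `v`; its vertex `0` is identified
with `v`. -/
def addedCycleVertex {V : Type*} (G : SimpleGraph V) (n : ℕ)
    (v : {v : V // (G.neighborSet v).ncard = 2}) (i : Fin n) : AddCyclesVertex G n :=
  if h : (i : ℕ) = 0 then Sum.inl v.1 else Sum.inr (v, ⟨i, h⟩)

/-- The graph obtained from `G` by adding a cycle of length `n` to every vertex of degree two. -/
def addCycles {V : Type*} (G : SimpleGraph V) (n : ℕ) : SimpleGraph (AddCyclesVertex G n) :=
  G.map Sum.inl ⊔ ⨆ v, (SimpleGraph.cycleGraph n).map (addedCycleVertex G n v)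

/-- The graph `G_r^n` together with its vertex set: `G_0^n` is a cycle of length `n`, and
`G_{r+1}^n` is obtained from `G_r^n` by adding a cycle of length `n` to every vertex of
degree two. -/
def cycleTreePair (n : ℕ) : ℕ → Σ V : Type, SimpleGraph V
  | 0 => ⟨Fin n, SimpleGraph.cycleGraph n⟩
  | r + 1 => ⟨AddCyclesVertex (cycleTreePair n r).2 n, addCycles (cycleTreePair n r).2 n⟩

/-- The vertex set of `G_r^n`. -/
abbrev CycleTreeVertex (n r : ℕ) : Type := (cycleTreePair n r).1

/-- The graph `G_r^n`. -/
abbrev cycleTree (n r : ℕ) : SimpleGraph (CycleTreeVertex n r) := (cycleTreePair n r).2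

/-! ### Subdivisions -/

/-- The vertices of the `k`-subdivision: those of `G`, and `x(e)_1, …, x(e)_{k-1}` for each edge
`e` of `G`. The vertex `x(e)_i` is `Sum.inr (e, i - 1)`. -/
abbrev SubdivisionVertex {V : Type*} (G : SimpleGraph V) (k : ℕ) : Type _ :=
  V ⊕ (G.edgeSet × Fin (k - 1))

/-- The path `u, x(e)_1, …, x(e)_{k-1}, v` that replaces the edge `e = (u, v)`; the order of the two
ends of `e` is chosen arbitrarily, by `Quot.out`. -/
def subdivisionPath {V : Type*} (G : SimpleGraph V) (k : ℕ) (e : G.edgeSet) (i : Fin (k + 1)) :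
    SubdivisionVertex G k :=
  if h0 : (i : ℕ) = 0 then Sum.inl (Quot.out e.1).1
  else if hk : (i : ℕ) = k then Sum.inl (Quot.out e.1).2
  else Sum.inr (e, ⟨(i : ℕ) - 1, by omega⟩)

/-- The `k`-subdivision `S_k(G)` (`k ≥ 1`): every edge of `G` is replaced by a path of `k` new
edges. -/
def subdivision {V : Type*} (G : SimpleGraph V) (k : ℕ) : SimpleGraph (SubdivisionVertex G k) :=
  ⨆ e, (SimpleGraph.pathGraph (k + 1)).map (subdivisionPath G k e)

end

/-!
The two terms of the binomial of an even closed Eulerian trail split the edges into two classes such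
that each vertex has as many edges in one class as in the other; that is, signs `±1` on the edges
cancel at each vertex (`IsBalancedSigning`). A binomial of the toric ideal whose terms divide those
of `B_w` amounts to a part of the edges on which the same signs still cancel. Hence `B_w` is
primitive as soon as such a part contains, at each vertex, all edges or none: the trail then carries
this alternative from one edge to the next.

At a vertex of degree two the alternative is clear. At any other vertex `p` the graph comes apart
into two sides, with two edges at `p` each, such that one side has an odd number of edges
(`IsOddSeparation`). Summing the signs over the vertices of this side, in which each of its edges
counts twice except for the two at `p`, shows that these two have the same sign
(`IsBalancedSigning.sum_separation`); the same sum for a part of the edges shows that the part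
contains both or none of them, and then the same holds on the other side
(`IsBalancedSigning.eq_zero_iff`).

As all degrees are `2` or `4`, the parity of the number of edges is that of the number of vertices
of degree two, which is easy to follow through the two constructions. Every added cycle brings
`n - 1` new vertices of degree two, while all old vertices get degree four
(`HasOddSeparations.addCycles`), and every subdivided edge brings `k - 1` of them
(`HasOddSeparations.subdivision`). The same count for the whole graph gives the even length, and
this is where `r ≥ 1` enters.

Irreducibility holds because the two terms are squarefree and coprime, so that the binomial has
degree one in a variable, with coprime coefficients (`irreducible_monomial_sub_monomial`).
-/

/-! ### Odd separations and balanced signings -/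

/-- `T` is one side of an odd separation of `G` at the vertex `p`: no edge leads from `T` to a
vertex outside `T ∪ {p}`, the vertex `p` has two neighbours in `T` and two outside of `T`, and `T`
contains an even number of vertices of degree two. When all degrees are `2` or `4`, the last
condition says that the number of edges with an end in `T` is odd. -/
structure IsOddSeparation {V : Type*} (G : SimpleGraph V) (p : V) (T : Set V) : Prop where
  notMem : p ∉ T
  closed : ∀ a ∈ T, ∀ b, G.Adj a b → b ∈ T ∨ b = p
  inside : (G.neighborSet p ∩ T).ncard = 2
  outside : (G.neighborSet p \ T).ncard = 2
  even : Even {v | v ∈ T ∧ (G.neighborSet v).ncard = 2}.ncard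

/-- Every vertex has degree two or admits an odd separation. -/
def HasOddSeparations {V : Type*} (G : SimpleGraph V) : Prop :=
  ∀ p, (G.neighborSet p).ncard = 2 ∨ ∃ T, IsOddSeparation G p T

theorem IsOddSeparation.ncard_neighborSet {V : Type*} {G : SimpleGraph V} {p : V} {T : Set V}
    (h : IsOddSeparation G p T) : (G.neighborSet p).ncard = 4 := by
  have h1 := h.inside
  have h2 := h.outside
  have f1 : (G.neighborSet p ∩ T).Finite := Set.finite_of_ncard_ne_zero (by omega)
  have f2 : (G.neighborSet p \ T).Finite := Set.finite_of_ncard_ne_zero (by omega)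
  have h3 := Set.ncard_union_eq
    (Set.disjoint_of_subset_left Set.inter_subset_right Set.disjoint_sdiff_right) f1 f2
  rw [Set.inter_union_sdiff] at h3
  omega

theorem HasOddSeparations.ncard_neighborSet {V : Type*} {G : SimpleGraph V}
    (h : HasOddSeparations G) (p : V) :
    (G.neighborSet p).ncard = 2 ∨ (G.neighborSet p).ncard = 4 :=
  (h p).imp_right fun ⟨_, hT⟩ => hT.ncard_neighborSet

theorem even_sum_sum_of_symm {V : Type*} (M : V → V → ℤ)
    (hM : ∀ a b, M a b = M b a) (h0 : ∀ a, M a a = 0) (T : Finset V) :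
    Even (∑ a ∈ T, ∑ b ∈ T, M a b) := by
  classical
  induction T using Finset.induction_on with
  | empty => simp
  | insert x T hx ih =>
    simp only [Finset.sum_insert hx, h0, Finset.sum_add_distrib]
    rw [Finset.sum_congr rfl fun a _ => hM a x]
    obtain ⟨c, hc⟩ := ih
    exact ⟨∑ b ∈ T, M x b + c, by rw [hc]; ring⟩

/-- A sum over a set in which `p` has exactly two neighbours. -/
theorem sum_eq_add_of_neighbors {V : Type*} {G : SimpleGraph V} {p b c : V} {S : Finset V}
    (hbc : b ≠ c) (hS : G.neighborSet p ∩ S = {b, c}) (f : V → ℤ)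
    (hf : ∀ a, ¬ G.Adj p a → f a = 0) : ∑ a ∈ S, f a = f b + f c := by
  classical
  rw [← Finset.sum_pair hbc]
  have hsub : ∀ a, a ∈ ({b, c} : Finset V) ↔ G.Adj p a ∧ a ∈ S := by
    intro a
    have := Set.ext_iff.1 hS a
    simp only [Set.mem_inter_iff, SimpleGraph.mem_neighborSet, Finset.mem_coe,
      Set.mem_insert_iff, Set.mem_singleton_iff] at this
    simp [this]
  refine (Finset.sum_subset (fun a ha => ((hsub a).1 ha).2) fun a haS ha => hf a fun h => ?_).symm
  exact ha ((hsub a).2 ⟨h, haS⟩)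

/-- Summing the rows of `M` over one side of a separation at `p` only leaves the part of `M` inside
this side and the entries at `p`. -/
theorem sum_rows_of_closed {V : Type*} [Fintype V] {G : SimpleGraph V} {p : V} {T : Finset V}
    (hp : p ∉ T) (hT : ∀ a ∈ T, ∀ b, G.Adj a b → b ∈ T ∨ b = p) (M : V → V → ℤ)
    (hM : ∀ a b, M a b = M b a) (h0 : ∀ a b, ¬ G.Adj a b → M a b = 0) :
    ∑ a ∈ T, ∑ b, M a b = ∑ a ∈ T, ∑ b ∈ T, M a b + ∑ a ∈ T, M p a := by
  classical
  rw [← Finset.sum_add_distrib]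
  refine Finset.sum_congr rfl fun a ha => ?_
  rw [hM p a, add_comm, ← Finset.sum_insert hp]
  refine (Finset.sum_subset (Finset.subset_univ _) fun b _ hb => h0 a b fun h => hb ?_).symm
  rcases hT a ha b h with h | h <;> simp [h]

theorem four_dvd_sum_ncard_neighborSet {V : Type*} {G : SimpleGraph V}
    (h : HasOddSeparations G) (T : Finset V)
    (hT : Even {v | v ∈ T ∧ (G.neighborSet v).ncard = 2}.ncard) :
    4 ∣ ∑ a ∈ T, ((G.neighborSet a).ncard : ℤ) := by
  classical
  have h1 : ∀ a ∈ T, ((G.neighborSet a).ncard : ℤ) =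
      4 - 2 * if (G.neighborSet a).ncard = 2 then 1 else 0 := by
    intro a _
    rcases h.ncard_neighborSet a with h | h <;> simp [h]
  have h2 : {v | v ∈ T ∧ (G.neighborSet v).ncard = 2} =
      ((T.filter fun v => (G.neighborSet v).ncard = 2 : Finset V) : Set V) := by
    ext; simp
  rw [h2, Set.ncard_coe_finset] at hT
  obtain ⟨m, hm⟩ := hT
  rw [Finset.sum_congr rfl h1, Finset.sum_sub_distrib, ← Finset.mul_sum, Finset.sum_boole, hm]
  simp only [Finset.sum_const, nsmul_eq_mul]
  push_cast
  exact ⟨T.card - m, by ring⟩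

/-- A signing of the edges of a graph, as a symmetric matrix with entries in `{0, 1, -1}`, whose
signs cancel at each vertex. -/
structure IsBalancedSigning {V : Type*} [Fintype V] (G : SimpleGraph V) (D : V → V → ℤ) :
    Prop where
  symm : ∀ a b, D a b = D b a
  zero : ∀ a b, ¬ G.Adj a b → D a b = 0
  sign : ∀ a b, G.Adj a b → D a b = 1 ∨ D a b = -1
  sum : ∀ a, ∑ b, D a b = 0

/-- At an odd separation, the two edges on the side `T` have the same sign: a sum of two signs is
`2` modulo `4` only if they agree. Modulo `4`, the sum of the entries inside `T`, where each edge
counts twice, is twice the number of edges inside `T`, which the degrees determine. -/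
theorem IsBalancedSigning.sum_separation {V : Type*} [Fintype V] {G : SimpleGraph V}
    {D : V → V → ℤ} (hD : IsBalancedSigning G D) (h : HasOddSeparations G) {p b c : V}
    {T : Finset V} (hT : IsOddSeparation G p T) (hbc : b ≠ c)
    (hS : G.neighborSet p ∩ T = {b, c}) : ∃ m, D p b + D p c = 4 * m + 2 := by
  classical
  let A : V → V → ℤ := fun a b => if G.Adj a b then 1 else 0
  let N : V → V → ℤ := fun a b => if D a b = -1 then 1 else 0
  have hp : p ∉ T := by simpa using hT.notMem
  have hc : ∀ a ∈ T, ∀ b, G.Adj a b → b ∈ T ∨ b = p := fun a ha b hab => by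
    simpa using hT.closed a (by simpa using ha) b hab
  have hdeg : ∀ a, ∑ b, A a b = ((G.neighborSet a).ncard : ℤ) := by
    intro a
    have : G.neighborSet a = ((Finset.univ.filter fun b => G.Adj a b : Finset V) : Set V) := by
      ext; simp
    rw [this, Set.ncard_coe_finset]
    simp [A]
  have hAsum := sum_rows_of_closed hp hc A (fun a b => by simp [A, G.adj_comm])
    (fun a b hab => by simp [A, hab])
  have hDsum := sum_rows_of_closed hp hc D hD.symm hD.zero
  have hpb : G.Adj p b := (Set.ext_iff.1 hS b).2 (by simp) |>.1
  have hpc : G.Adj p c := (Set.ext_iff.1 hS c).2 (by simp) |>.1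
  have hA2 : ∑ a ∈ T, A p a = 2 := by
    rw [sum_eq_add_of_neighbors hbc hS _ fun a ha => by simp [A, ha]]
    simp [A, hpb, hpc]
  have hD2 := sum_eq_add_of_neighbors hbc hS (D p) (hD.zero p)
  have hAD : ∀ a b, A a b = D a b + 2 * N a b := by
    intro a b
    by_cases hab : G.Adj a b
    · rcases hD.sign a b hab with h | h <;> simp [A, N, hab, h]
    · simp [A, N, hab, hD.zero a b hab]
  obtain ⟨x, hx⟩ := even_sum_sum_of_symm N (fun a b => by simp [N, hD.symm a b])
    (fun a => by simp [N, hD.zero a a]) T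
  obtain ⟨y, hy⟩ := four_dvd_sum_ncard_neighborSet h T (by simpa using hT.even)
  have hsplit : ∑ a ∈ T, ∑ b ∈ T, A a b =
      ∑ a ∈ T, ∑ b ∈ T, D a b + 2 * ∑ a ∈ T, ∑ b ∈ T, N a b := by
    simp only [hAD, Finset.sum_add_distrib, Finset.mul_sum]
  simp only [hdeg] at hAsum
  simp only [hD.sum, Finset.sum_const_zero] at hDsum
  exact ⟨x - y, by linarith⟩

/-- A part `D'` of a balanced signing `D` whose signs cancel at each vertex too uses all edges at a
vertex or none. At an odd separation, the sum of the entries of `D'` inside `T` is even, so `D'` uses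
both or none of the two edges on this side, which have the same sign in `D`; the two edges on the
other side have the opposite sign. -/
theorem IsBalancedSigning.eq_zero_iff {V : Type*} [Fintype V] {G : SimpleGraph V}
    {D : V → V → ℤ} (hD : IsBalancedSigning G D) (h : HasOddSeparations G) {D' : V → V → ℤ}
    (hsymm : ∀ a b, D' a b = D' b a) (hsub : ∀ a b, D' a b = 0 ∨ D' a b = D a b)
    (hsum : ∀ a, ∑ b, D' a b = 0) {p b c : V} (hb : G.Adj p b) (hc : G.Adj p c) :
    D' p b = 0 ↔ D' p c = 0 := by
  classical
  have hzero : ∀ a b, ¬ G.Adj a b → D' a b = 0 := fun a b hab => by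
    rcases hsub a b with h | h
    · exact h
    · rw [h, hD.zero a b hab]
  rcases h p with h2 | ⟨T, hT⟩
  · obtain ⟨x, y, hxy, hN⟩ := Set.ncard_eq_two.1 h2
    have hN' : G.neighborSet p ∩ (Finset.univ : Finset V) = {x, y} := by simpa using hN
    have e := sum_eq_add_of_neighbors hxy hN' (D' p) (hzero p)
    rw [hsum] at e
    have hb' : b = x ∨ b = y := by simpa using (Set.ext_iff.1 hN b).1 hb
    have hc' : c = x ∨ c = y := by simpa using (Set.ext_iff.1 hN c).1 hc
    rcases hb' with rfl | rfl <;> rcases hc' with rfl | rfl <;> constructor <;> intro h <;> omega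
  · obtain ⟨T, rfl⟩ : ∃ S : Finset V, (S : Set V) = T := ⟨T.toFinite.toFinset, by simp⟩
    obtain ⟨x, y, hxy, hN⟩ := Set.ncard_eq_two.1 hT.inside
    obtain ⟨z, t, hzt, hN₂⟩ := Set.ncard_eq_two.1 hT.outside
    have hNc : G.neighborSet p ∩ (Tᶜ : Finset V) = {z, t} := by
      rw [← hN₂, Finset.coe_compl, Set.sdiff_eq]
    have hp : p ∉ T := by simpa using hT.notMem
    have hcl : ∀ a ∈ T, ∀ b, G.Adj a b → b ∈ T ∨ b = p := fun a ha b hab => by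
      simpa using hT.closed a (by simpa using ha) b hab
    obtain ⟨m, hm⟩ := hD.sum_separation h hT hxy hN
    have e1 := sum_eq_add_of_neighbors hxy hN (D p) (hD.zero p)
    have e2 := sum_eq_add_of_neighbors hzt hNc (D p) (hD.zero p)
    have e3 := sum_eq_add_of_neighbors hxy hN (D' p) (hzero p)
    have e4 := sum_eq_add_of_neighbors hzt hNc (D' p) (hzero p)
    have e5 := Finset.sum_add_sum_compl T (D p)
    have e6 := Finset.sum_add_sum_compl T (D' p)
    rw [hD.sum] at e5
    rw [hsum] at e6
    have e7 := sum_rows_of_closed hp hcl D' hsymm hzero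
    obtain ⟨k, hk⟩ := even_sum_sum_of_symm D' hsymm
      (fun a => hzero a a (G.irrefl)) T
    simp only [hsum, Finset.sum_const_zero] at e7
    have hadj : ∀ v, G.Adj p v ↔ v = x ∨ v = y ∨ v = z ∨ v = t := by
      intro v
      have h1 := Set.ext_iff.1 hN v
      have h2 := Set.ext_iff.1 hN₂ v
      simp only [Set.mem_inter_iff, SimpleGraph.mem_neighborSet, Finset.mem_coe, Set.mem_sdiff,
        Set.mem_insert_iff, Set.mem_singleton_iff] at h1 h2
      tauto
    have sx := hD.sign p x ((hadj x).2 (by simp))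
    have sy := hD.sign p y ((hadj y).2 (by simp))
    have sz := hD.sign p z ((hadj z).2 (by simp))
    have st := hD.sign p t ((hadj t).2 (by simp))
    have dx := hsub p x
    have dy := hsub p y
    have dz := hsub p z
    have dt := hsub p t
    have key : (D' p x = 0 ↔ D' p y = 0) ∧ (D' p z = 0 ↔ D' p t = 0) ∧
        (D' p x = 0 ↔ D' p z = 0) := by
      rw [e1, e2] at e5
      rw [e3, e4] at e6
      rw [e3, hk] at e7
      clear e1 e2 e3 e4 hk hadj hN hN₂ hNc
      generalize D p x = X at *
      generalize D p y = Y at *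
      generalize D p z = Z at *
      generalize D p t = U at *
      generalize D' p x = X' at *
      generalize D' p y = Y' at *
      generalize D' p z = Z' at *
      generalize D' p t = U' at *
      have hXY : Y = X := by clear * - sx sy hm; omega
      subst hXY
      have hZ : Z = -Y := by clear * - sx sz st e5; omega
      have hU : U = -Y := by clear * - sx sz st e5; omega
      subst hZ hU
      have hXY' : Y' = X' := by clear * - sx dx dy e7; omega
      subst hXY'
      clear * - sx dy dz dt e6
      refine ⟨Iff.rfl, ?_, ?_⟩ <;> omega
    obtain ⟨k₁, k₂, k₃⟩ := key
    have hall : ∀ v, G.Adj p v → (D' p v = 0 ↔ D' p x = 0) := by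
      intro v hv
      rcases (hadj v).1 hv with h | h | h | h <;> rw [h]
      · exact k₁.symm
      · exact k₃.symm
      · exact k₂.symm.trans k₃.symm
    exact (hall b hb).trans (hall c hc).symm

/-! ### Binomials in toric ideals -/

/-- The toric ideal lies in the kernel of the map `x_i ↦ t^(a_i)` to the monoid algebra, so its
binomials are homogeneous for the `A`-degree. -/
theorem linearCombination_eq_of_mem_toricIdeal {K σ M : Type*} [Field K] [AddCommMonoid M]
    {a : σ → M} {u v : σ →₀ ℕ}
    (h : (MvPolynomial.monomial u 1 - MvPolynomial.monomial v 1 : MvPolynomial σ K) ∈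
      toricIdeal K a) :
    Finsupp.linearCombination ℕ a u = Finsupp.linearCombination ℕ a v := by
  classical
  let φ : MvPolynomial σ K →ₐ[K] AddMonoidAlgebra K M :=
    MvPolynomial.aeval fun i => AddMonoidAlgebra.of K M (Multiplicative.ofAdd (a i))
  have hφ : ∀ u : σ →₀ ℕ, φ (MvPolynomial.monomial u 1) =
      AddMonoidAlgebra.of K M (Multiplicative.ofAdd (Finsupp.linearCombination ℕ a u)) := by
    intro u
    simp only [φ, MvPolynomial.aeval_monomial, map_one, one_mul, ← map_pow]
    rw [← map_finsuppProd]
    simp [Finsupp.linearCombination_apply, Finsupp.prod, Finsupp.sum, ofAdd_sum, ofAdd_nsmul]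
  have hle : toricIdeal K a ≤ RingHom.ker φ := by
    refine Ideal.span_le.2 ?_
    rintro _ ⟨u, v, huv, rfl⟩
    simp [RingHom.mem_ker, map_sub, hφ, huv]
  have := hle h
  rw [RingHom.mem_ker, map_sub, hφ, hφ, sub_eq_zero] at this
  exact Multiplicative.ofAdd.injective (AddMonoidAlgebra.of_injective this)

/-- A binomial with coprime terms that has degree one in some variable is irreducible. -/
theorem irreducible_monomial_sub_monomial {K σ : Type*} [Field K] {u v : σ →₀ ℕ} {i : σ}
    (hi : u i = 1) (huv : ∀ j, u j = 0 ∨ v j = 0) :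
    Irreducible (MvPolynomial.monomial u 1 - MvPolynomial.monomial v 1 : MvPolynomial σ K) := by
  classical
  have hvi : v i = 0 := (huv i).resolve_left (by omega)
  have hle : Finsupp.single i 1 ≤ u := by simp [hi]
  have hu : (MvPolynomial.monomial u 1 : MvPolynomial σ K) =
      MvPolynomial.monomial (u - Finsupp.single i 1) 1 * MvPolynomial.X i := by
    rw [MvPolynomial.X, MvPolynomial.monomial_mul, tsub_add_cancel_of_le hle, one_mul]
  rw [hu, sub_eq_add_neg]
  refine MvPolynomial.irreducible_mul_X_add _ _ i (by simp) ?_ ?_ ?_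
  · rw [MvPolynomial.vars_monomial one_ne_zero]
    simp [hi]
  · rw [MvPolynomial.vars_neg, MvPolynomial.vars_monomial one_ne_zero]
    simp [hvi]
  · intro d h1 h2
    rw [dvd_neg] at h2
    obtain ⟨m, r, hm, hr, rfl⟩ := (MvPolynomial.dvd_monomial_iff_exists one_ne_zero).1 h1
    have h3 := (MvPolynomial.monomial_dvd_monomial.1 h2).1.resolve_left one_ne_zero
    have : m = 0 := by
      ext j
      have a1 := hm j
      have a2 := h3 j
      rcases huv j with h | h
      · simp [h] at a1; simpa using a1
      · simp [h] at a2; simpa using a2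
    subst this
    exact (isUnit_of_dvd_one hr).map MvPolynomial.C

/-! ### The binomial of an even closed walk -/

/-- The exponent vector of the product of the entries of a list at the positions satisfying `P`,
where positions start at `0`. -/
noncomputable def listExponent {σ : Type*} (P : ℕ → Prop) [DecidablePred P] (l : List σ) : σ →₀ ℕ :=
  ∑ i : Fin l.length, if P i then Finsupp.single (l.get i) 1 else 0

theorem prod_ite_X_eq_monomial (K : Type*) [Field K] {σ : Type*} (P : ℕ → Prop)
    [DecidablePred P] (l : List σ) :
    (∏ i : Fin l.length, if P i then (MvPolynomial.X (l.get i) : MvPolynomial σ K) else 1) =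
      MvPolynomial.monomial (listExponent P l) 1 := by
  rw [listExponent, MvPolynomial.monomial_sum_one]
  refine Finset.prod_congr rfl fun i _ => ?_
  split_ifs <;> rfl

theorem listExponent_even_cons {σ : Type*} (e : σ) (l : List σ) :
    listExponent Even (e :: l) = Finsupp.single e 1 + listExponent Odd l := by
  simp [listExponent, Fin.sum_univ_succ, Nat.even_add_one]

theorem listExponent_odd_cons {σ : Type*} (e : σ) (l : List σ) :
    listExponent Odd (e :: l) = listExponent Even l := by
  simp [listExponent, Fin.sum_univ_succ, Nat.odd_add_one]

theorem listExponent_even_add_odd {σ : Type*} [BEq σ] [LawfulBEq σ] (l : List σ) (e : σ) :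
    listExponent Even l e + listExponent Odd l e = l.count e := by
  classical
  induction l with
  | nil => simp [listExponent]
  | cons a l ih =>
    rw [listExponent_even_cons, listExponent_odd_cons, List.count_cons, ← ih, Finsupp.add_apply,
      Finsupp.single_apply]
    simp only [beq_iff_eq]
    ring

/-- The alternating sum of the edge vectors along a walk telescopes. -/
theorem linearCombination_edgeVector_walk {V : Type*} {G : SimpleGraph V} {x y : V}
    (w : G.Walk x y) :
    Finsupp.linearCombination ℕ (edgeVector G) (listExponent Even (walkEdges w)) -
      Finsupp.linearCombination ℕ (edgeVector G) (listExponent Odd (walkEdges w)) =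
      Finsupp.single x 1 - (-1 : ℤ) ^ w.length • Finsupp.single y (1 : ℤ) := by
  induction w with
  | nil =>
    have : ∀ P : ℕ → Prop, ∀ _ : DecidablePred P, listExponent P ([] : List G.edgeSet) = 0 :=
      fun _ _ => rfl
    simp [walkEdges, this]
  | @cons a b c h p ih =>
    have : walkEdges (SimpleGraph.Walk.cons h p) = ⟨s(a, b), h⟩ :: walkEdges p := rfl
    rw [this, listExponent_even_cons, listExponent_odd_cons, map_add,
      Finsupp.linearCombination_single, one_smul, SimpleGraph.Walk.length_cons, pow_succ]
    have he : edgeVector G ⟨s(a, b), h⟩ = Finsupp.single a 1 + Finsupp.single b 1 := rfl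
    rw [he, mul_neg_one, neg_smul, add_sub_assoc, ← neg_sub (Finsupp.linearCombination _ _ _), ih]
    abel

theorem walkEdges_map_val {V : Type*} {G : SimpleGraph V} {x y : V} (w : G.Walk x y) :
    (walkEdges w).map Subtype.val = w.edges := by
  simp [walkEdges, SimpleGraph.Walk.edges, Function.comp_def]

theorem listExponent_add_of_isEulerian {V : Type*} [DecidableEq V] {G : SimpleGraph V} {x y : V}
    {w : G.Walk x y} (hw : w.IsEulerian) (e : G.edgeSet) :
    listExponent Even (walkEdges w) e + listExponent Odd (walkEdges w) e = 1 := by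
  rw [listExponent_even_add_odd, ← hw e.1 e.2, ← walkEdges_map_val,
    List.count_map_of_injective _ _ Subtype.val_injective]

/-- A function on the edges that is constant on the edges at each vertex is constant on the edges
of a walk. -/
theorem eq_of_mem_walkEdges {V α : Type*} {G : SimpleGraph V} (s : G.edgeSet → α)
    (hs : ∀ (p b c : V) (hb : G.Adj p b) (hc : G.Adj p c), s ⟨s(p, b), hb⟩ = s ⟨s(p, c), hc⟩)
    {x y : V} (w : G.Walk x y) (b : V) (hb : G.Adj x b) :
    ∀ e ∈ walkEdges w, s e = s ⟨s(x, b), hb⟩ := by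
  induction w generalizing b with
  | nil => simp [walkEdges]
  | @cons a c d h p ih =>
    have : walkEdges (SimpleGraph.Walk.cons h p) = ⟨s(a, c), h⟩ :: walkEdges p := rfl
    intro e he
    rw [this, List.mem_cons] at he
    rcases he with rfl | he
    · exact hs _ _ _ _ _
    · have h' : (⟨s(c, a), h.symm⟩ : G.edgeSet) = ⟨s(a, c), h⟩ := Subtype.ext Sym2.eq_swap
      rw [ih a h.symm e he, h']
      exact hs _ _ _ _ _

/-! ### Edge functions as symmetric matrices -/

/-- The symmetric matrix with entries `f e` at the two positions of each edge `e`, and `0`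
elsewhere. -/
def edgeMatrix {V : Type*} (G : SimpleGraph V) [Fintype G.edgeSet] [DecidableEq V]
    (f : G.edgeSet → ℤ) (a b : V) : ℤ :=
  ∑ e, if e.1 = s(a, b) then f e else 0

theorem linearCombination_edgeVector_apply {V : Type*} {G : SimpleGraph V} [Fintype G.edgeSet]
    (u : G.edgeSet →₀ ℕ) (p : V) :
    Finsupp.linearCombination ℕ (edgeVector G) u p = ∑ e, (u e : ℤ) * edgeVector G e p := by
  rw [Finsupp.linearCombination_apply, Finsupp.sum_fintype _ _ (by simp), Finsupp.finsetSum_apply]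
  simp

section edgeMatrix

variable {V : Type*} {G : SimpleGraph V} [Fintype G.edgeSet] [DecidableEq V] (f : G.edgeSet → ℤ)

theorem edgeMatrix_symm (a b : V) : edgeMatrix G f a b = edgeMatrix G f b a := by
  simp only [edgeMatrix, Sym2.eq_swap (a := a)]

theorem edgeMatrix_of_adj {a b : V} (h : G.Adj a b) : edgeMatrix G f a b = f ⟨s(a, b), h⟩ := by
  rw [edgeMatrix, Finset.sum_eq_single ⟨s(a, b), h⟩]
  · simp
  · intro e _ he
    rw [if_neg fun h' => he (Subtype.ext h')]
  · simp

theorem edgeMatrix_of_not_adj {a b : V} (h : ¬ G.Adj a b) : edgeMatrix G f a b = 0 := by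
  refine Finset.sum_eq_zero fun e _ => if_neg fun h' => h ?_
  have := e.2
  rwa [h'] at this

theorem sum_edgeMatrix [Fintype V] (p : V) :
    ∑ b, edgeMatrix G f p b = ∑ e, f e * edgeVector G e p := by
  simp only [edgeMatrix]
  rw [Finset.sum_comm]
  refine Finset.sum_congr rfl fun ⟨e, he⟩ _ => ?_
  induction e with
  | _ x y =>
    have hxy : x ≠ y := G.ne_of_adj he
    have hv : edgeVector G ⟨s(x, y), he⟩ = Finsupp.single x 1 + Finsupp.single y 1 := rfl
    rw [hv, Finsupp.add_apply, Finsupp.single_apply, Finsupp.single_apply, mul_add]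
    have : ∀ b, (if s(x, y) = s(p, b) then f ⟨s(x, y), he⟩ else 0) =
        (if y = b then (if x = p then f ⟨s(x, y), he⟩ else 0) else 0) +
        (if x = b then (if y = p then f ⟨s(x, y), he⟩ else 0) else 0) := by
      intro b
      simp only [Sym2.eq_iff]
      grind
    simp only [this, Finset.sum_add_distrib, Finset.sum_ite_eq, Finset.mem_univ, if_true]
    simp

/-- Equality of the degrees of two exponent vectors says that the rows of the matrix of their
difference sum to zero. -/
theorem sum_edgeMatrix_sub_eq_zero [Fintype V] {u v : G.edgeSet →₀ ℕ}
    (h : Finsupp.linearCombination ℕ (edgeVector G) u =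
      Finsupp.linearCombination ℕ (edgeVector G) v) (p : V) :
    ∑ b, edgeMatrix G (fun e => (u e : ℤ) - v e) p b = 0 := by
  have := congrArg (· p) h
  simp only [linearCombination_edgeVector_apply] at this
  rw [sum_edgeMatrix]
  simp only [sub_mul, Finset.sum_sub_distrib, this, sub_self]

end edgeMatrix

/-! ### Eulerian trails of graphs with odd separations -/

theorem HasOddSeparations.even_length {V : Type*} [Finite V] [DecidableEq V] {G : SimpleGraph V}
    (h : HasOddSeparations G) (heven : Even {v | (G.neighborSet v).ncard = 2}.ncard) {x y : V}
    {w : G.Walk x y} (hw : w.IsEulerian) : Even w.length := by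
  classical
  have := Fintype.ofFinite V
  have h1 := four_dvd_sum_ncard_neighborSet h Finset.univ (by simpa using heven)
  have h2 := G.sum_degrees_eq_twice_card_edges
  have h3 : w.length = G.edgeFinset.card := by
    rw [← hw.edgesFinset_eq]
    exact w.length_edges.symm
  have h4 : ∀ v, (G.neighborSet v).ncard = G.degree v := fun v => by
    rw [Set.ncard_eq_toFinset_card']
    rfl
  simp only [h4] at h1
  rw [← Nat.cast_sum, h2, ← h3] at h1
  exact Nat.even_iff.2 (by omega)

/-- The two terms of the binomial of an Eulerian trail define a balanced signing of the edges, and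
a binomial whose terms divide them is a balanced signing of a part of the edges; this part is all or
nothing at each vertex, hence along the trail. -/
theorem HasOddSeparations.walkBinomial_mem_graverBasis (K : Type*) [Field K] {V : Type*} [Finite V]
    [DecidableEq V] {G : SimpleGraph V} (h : HasOddSeparations G)
    (heven : Even {v | (G.neighborSet v).ncard = 2}.ncard) {x : V}
    {w : G.Walk x x} (hw : w.IsEulerian) :
    walkBinomial K w ∈ graverBasis K (edgeVector G) := by
  classical
  have := Fintype.ofFinite V
  have hlen := h.even_length heven hw
  obtain ⟨y, hy⟩ : ∃ y, G.Adj x y := by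
    have : (G.neighborSet x).ncard ≠ 0 := by rcases h.ncard_neighborSet x with h | h <;> omega
    exact Set.nonempty_of_ncard_ne_zero this
  have hmem : ∀ e, e ∈ walkEdges w := by
    intro e
    have : e.1 ∈ (walkEdges w).map Subtype.val := by
      rw [walkEdges_map_val]
      exact hw.mem_edges_iff.2 e.2
    simpa using this
  have hdeg : Finsupp.linearCombination ℕ (edgeVector G) (listExponent Even (walkEdges w)) =
      Finsupp.linearCombination ℕ (edgeVector G) (listExponent Odd (walkEdges w)) := by
    rw [← sub_eq_zero, linearCombination_edgeVector_walk, hlen.neg_one_pow, one_smul, sub_self]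
  have hone := listExponent_add_of_isEulerian hw
  obtain ⟨i, hi⟩ : ∃ i, listExponent Even (walkEdges w) i = 1 := by
    cases w with
    | nil => exact absurd (hmem ⟨s(x, y), hy⟩) (by simp [walkEdges])
    | @cons _ b _ hb p =>
      refine ⟨⟨s(x, b), hb⟩, ?_⟩
      have h1 := hone ⟨s(x, b), hb⟩
      have : walkEdges (SimpleGraph.Walk.cons hb p) = ⟨s(x, b), hb⟩ :: walkEdges p := rfl
      rw [this, listExponent_even_cons, Finsupp.add_apply, Finsupp.single_eq_same] at h1 ⊢
      omega
  have hbin : walkBinomial K w = MvPolynomial.monomial (listExponent Even (walkEdges w)) 1 -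
      MvPolynomial.monomial (listExponent Odd (walkEdges w)) 1 := by
    rw [walkBinomial, prod_ite_X_eq_monomial, prod_ite_X_eq_monomial]
  generalize listExponent Even (walkEdges w) = u at *
  generalize listExponent Odd (walkEdges w) = v at *
  refine ⟨u, v, hbin, ?_, ?_, ?_⟩
  · rw [hbin]
    exact irreducible_monomial_sub_monomial hi fun j => by have := hone j; omega
  · rw [hbin]
    exact Ideal.subset_span ⟨u, v, hdeg, rfl⟩
  rintro ⟨s, t, hst, hne, hI, hs, ht⟩
  have hsu := (MvPolynomial.monomial_dvd_monomial.1 hs).1.resolve_left one_ne_zero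
  have htv := (MvPolynomial.monomial_dvd_monomial.1 ht).1.resolve_left one_ne_zero
  have hdeg' := linearCombination_eq_of_mem_toricIdeal hI
  have hD : IsBalancedSigning G (edgeMatrix G fun e => (u e : ℤ) - v e) :=
    { symm := edgeMatrix_symm _
      zero := fun a b hab => edgeMatrix_of_not_adj _ hab
      sign := fun a b hab => by
        rw [edgeMatrix_of_adj _ hab]
        have := hone ⟨s(a, b), hab⟩
        omega
      sum := sum_edgeMatrix_sub_eq_zero hdeg }
  have hsub : ∀ e, (s e : ℤ) - t e = 0 ∨ (s e : ℤ) - t e = u e - v e := fun e => by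
    have h1 := hsu e
    have h2 := htv e
    have h3 := hone e
    omega
  have hloc : ∀ (p b c : V) (hb : G.Adj p b) (hc : G.Adj p c),
      ((s ⟨s(p, b), hb⟩ : ℤ) - t ⟨s(p, b), hb⟩ = 0) =
        ((s ⟨s(p, c), hc⟩ : ℤ) - t ⟨s(p, c), hc⟩ = 0) := by
    intro p b c hb hc
    have := hD.eq_zero_iff h (D' := edgeMatrix G fun e => (s e : ℤ) - t e) (edgeMatrix_symm _)
      (fun a b => by
        by_cases hab : G.Adj a b
        · simp only [edgeMatrix_of_adj _ hab]
          exact hsub _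
        · exact Or.inl (edgeMatrix_of_not_adj _ hab))
      (sum_edgeMatrix_sub_eq_zero hdeg') hb hc
    rw [edgeMatrix_of_adj _ hb, edgeMatrix_of_adj _ hc] at this
    exact propext this
  have hconst := eq_of_mem_walkEdges (fun e => (s e : ℤ) - t e = 0) hloc w y hy
  by_cases h0 : (s ⟨s(x, y), hy⟩ : ℤ) - t ⟨s(x, y), hy⟩ = 0
  · refine hst (Finsupp.ext fun e => ?_)
    have := (hconst e (hmem e)).mpr h0
    omega
  · have hall : ∀ e, s e = u e ∧ t e = v e := fun e => by
      have h1 := hsu e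
      have h2 := htv e
      have h3 := hone e
      have h4 : ¬ (s e : ℤ) - t e = 0 := fun h => h0 ((hconst e (hmem e)).mp h)
      omega
    exact hne (Prod.ext (Finsupp.ext fun e => (hall e).1) (Finsupp.ext fun e => (hall e).2))

/-! ### Adding cycles -/

theorem ncard_neighborSet_cycleGraph {n : ℕ} (hn : 3 ≤ n) (i : Fin n) :
    ((SimpleGraph.cycleGraph n).neighborSet i).ncard = 2 := by
  obtain ⟨m, rfl⟩ := Nat.exists_eq_add_of_le' hn
  rw [Set.ncard_eq_toFinset_card']
  exact SimpleGraph.cycleGraph_degree_three_le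

theorem addedCycleVertex_injective {V : Type*} (G : SimpleGraph V) (n : ℕ)
    (v : {v : V // (G.neighborSet v).ncard = 2}) :
    Function.Injective (addedCycleVertex G n v) := by
  intro i j h
  unfold addedCycleVertex at h
  split_ifs at h with h1 h2 h2
  · exact Fin.ext (h1.trans h2.symm)
  · simpa using h

theorem addCycles_adj {V : Type*} {G : SimpleGraph V} {n : ℕ} {x y : AddCyclesVertex G n} :
    (addCycles G n).Adj x y ↔ (∃ a b, G.Adj a b ∧ Sum.inl a = x ∧ Sum.inl b = y) ∨
      ∃ v i j, (SimpleGraph.cycleGraph n).Adj i j ∧ addedCycleVertex G n v i = x ∧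
        addedCycleVertex G n v j = y := by
  rw [addCycles, SimpleGraph.sup_adj, SimpleGraph.iSup_adj]
  refine or_congr (SimpleGraph.map_adj ⟨Sum.inl, Sum.inl_injective⟩ G x y)
    (exists_congr fun v => ?_)
  exact SimpleGraph.map_adj ⟨_, addedCycleVertex_injective G n v⟩ _ x y

theorem addedCycleVertex_eq_inl {V : Type*} {G : SimpleGraph V} {n : ℕ}
    {v : {v : V // (G.neighborSet v).ncard = 2}} {i : Fin n} {a : V} :
    addedCycleVertex G n v i = Sum.inl a ↔ (i : ℕ) = 0 ∧ v.1 = a := by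
  unfold addedCycleVertex
  split_ifs with h <;> simp [h]

theorem addedCycleVertex_eq_inr {V : Type*} {G : SimpleGraph V} {n : ℕ}
    {v v' : {v : V // (G.neighborSet v).ncard = 2}} {i : Fin n} {j : {i : Fin n // (i : ℕ) ≠ 0}} :
    addedCycleVertex G n v i = Sum.inr (v', j) ↔ v = v' ∧ i = j.1 := by
  unfold addedCycleVertex
  split_ifs with h
  · simp only [false_iff, not_and]
    rintro _ rfl
    exact j.2 h
  · simp [Subtype.ext_iff]

theorem addCycles_adj_inr {V : Type*} {G : SimpleGraph V} {n : ℕ}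
    {v : {v : V // (G.neighborSet v).ncard = 2}} {j : {i : Fin n // (i : ℕ) ≠ 0}}
    {y : AddCyclesVertex G n} :
    (addCycles G n).Adj (Sum.inr (v, j)) y ↔
      ∃ i, (SimpleGraph.cycleGraph n).Adj j i ∧ addedCycleVertex G n v i = y := by
  rw [addCycles_adj]
  simp only [addedCycleVertex_eq_inr]
  constructor
  · rintro (⟨_, _, _, h, _⟩ | ⟨v', i, i', h, ⟨rfl, rfl⟩, h'⟩)
    · simp at h
    · exact ⟨i', h, h'⟩
  · rintro ⟨i, h, h'⟩
    exact Or.inr ⟨v, j, i, h, ⟨rfl, rfl⟩, h'⟩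

theorem addCycles_adj_inl_inl {V : Type*} {G : SimpleGraph V} {n : ℕ} {a b : V} :
    (addCycles G n).Adj (Sum.inl a) (Sum.inl b) ↔ G.Adj a b := by
  rw [addCycles_adj]
  simp only [addedCycleVertex_eq_inl]
  constructor
  · rintro (⟨a', b', h, h1, h2⟩ | ⟨v, i, j, h, ⟨hi, -⟩, hj, -⟩)
    · obtain rfl := Sum.inl_injective h1
      obtain rfl := Sum.inl_injective h2
      exact h
    · exact absurd (Fin.ext (hi.trans hj.symm)) h.ne
  · exact fun h => Or.inl ⟨a, b, h, rfl, rfl⟩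

theorem ncard_neighborSet_addCycles_inr {V : Type*} {G : SimpleGraph V} {n : ℕ} (hn : 3 ≤ n)
    (q : {v : V // (G.neighborSet v).ncard = 2} × {i : Fin n // (i : ℕ) ≠ 0}) :
    ((addCycles G n).neighborSet (Sum.inr q)).ncard = 2 := by
  obtain ⟨v, j⟩ := q
  have : (addCycles G n).neighborSet (Sum.inr (v, j)) =
      addedCycleVertex G n v '' (SimpleGraph.cycleGraph n).neighborSet j := by
    ext y
    simp only [SimpleGraph.mem_neighborSet, addCycles_adj_inr, Set.mem_image]
  rw [this, Set.ncard_image_of_injective _ (addedCycleVertex_injective G n v),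
    ncard_neighborSet_cycleGraph hn]

/-- The neighbours of an old vertex `a` outside of the old graph: two if `a` had degree two. -/
theorem ncard_neighborSet_inter_range_inr {V : Type*} {G : SimpleGraph V} {n : ℕ} (hn : 3 ≤ n)
    {a : V} (ha : (G.neighborSet a).ncard = 2) :
    ((addCycles G n).neighborSet (Sum.inl a) ∩
      Sum.inr '' (({⟨a, ha⟩} : Set {v : V // (G.neighborSet v).ncard = 2}) ×ˢ
        (Set.univ : Set {i : Fin n // (i : ℕ) ≠ 0}))).ncard = 2 := by
  have : (addCycles G n).neighborSet (Sum.inl a) ∩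
      Sum.inr '' (({⟨a, ha⟩} : Set {v : V // (G.neighborSet v).ncard = 2}) ×ˢ
        (Set.univ : Set {i : Fin n // (i : ℕ) ≠ 0})) = addedCycleVertex G n ⟨a, ha⟩ ''
        (SimpleGraph.cycleGraph n).neighborSet ⟨0, by omega⟩ := by
    ext y
    rcases y with b | ⟨v, j⟩
    · simp only [Set.mem_inter_iff, Set.mem_image, reduceCtorEq, and_false, exists_false,
        false_iff, addedCycleVertex_eq_inl, not_exists, not_and]
      intro i hi h0
      exact absurd (Fin.ext h0.symm) (SimpleGraph.Adj.ne hi)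
    · simp only [Set.mem_inter_iff, SimpleGraph.mem_neighborSet, Set.mem_image, Set.mem_prod,
        Set.mem_singleton_iff, Set.mem_univ, and_true, Sum.inr.injEq, exists_eq_right,
        addedCycleVertex_eq_inr, (addCycles G n).adj_comm (Sum.inl a), addCycles_adj_inr,
        addedCycleVertex_eq_inl]
      constructor
      · rintro ⟨⟨i, hi, h0, -⟩, rfl⟩
        have hi0 : i = ⟨0, by omega⟩ := Fin.ext h0
        exact ⟨j.1, (hi0 ▸ hi).symm, rfl, rfl⟩
      · rintro ⟨i, hi, rfl, rfl⟩
        exact ⟨⟨_, hi.symm, rfl, rfl⟩, rfl⟩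
  rw [this, Set.ncard_image_of_injective _ (addedCycleVertex_injective G n _),
    ncard_neighborSet_cycleGraph hn]

/-- Each added cycle has an even number of new vertices. -/
theorem even_ncard_image_inr {V : Type*} {G : SimpleGraph V} {n : ℕ} (hn : Odd n)
    (S : Set {v : V // (G.neighborSet v).ncard = 2}) :
    Even ((Sum.inr '' (S ×ˢ (Set.univ : Set {i : Fin n // (i : ℕ) ≠ 0})) :
      Set (AddCyclesVertex G n))).ncard := by
  rw [Set.ncard_image_of_injective _ Sum.inr_injective, Set.ncard_prod, Set.ncard_univ]
  refine Even.mul_left ?_ _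
  obtain ⟨m, rfl⟩ := hn
  have : Nat.card {i : Fin (2 * m + 1) // (i : ℕ) ≠ 0} = 2 * m := by
    have h : ∀ i : Fin (2 * m + 1), (i : ℕ) ≠ 0 ↔ i ≠ 0 := fun i => Fin.val_ne_zero_iff
    rw [Nat.card_congr (Equiv.subtypeEquivRight h), Nat.card_eq_fintype_card]
    simp
  rw [this]
  exact even_two_mul m

theorem isOddSeparation_addedCycle {V : Type*} {G : SimpleGraph V} {n : ℕ} (hn : Odd n)
    (hn3 : 3 ≤ n) {a : V} (ha : (G.neighborSet a).ncard = 2) :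
    IsOddSeparation (addCycles G n) (Sum.inl a)
      (Sum.inr '' (({⟨a, ha⟩} : Set {v : V // (G.neighborSet v).ncard = 2}) ×ˢ
        (Set.univ : Set {i : Fin n // (i : ℕ) ≠ 0}))) where
  notMem := by simp
  closed := by
    rintro _ ⟨⟨v, j⟩, ⟨hv, -⟩, rfl⟩ y hy
    obtain rfl : v = ⟨a, ha⟩ := hv
    obtain ⟨i, -, rfl⟩ := addCycles_adj_inr.1 hy
    unfold addedCycleVertex
    split_ifs <;> simp
  inside := ncard_neighborSet_inter_range_inr hn3 ha
  outside := by
    refine Eq.trans ?_ ha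
    rw [← Set.ncard_image_of_injective (G.neighborSet a) (Sum.inl_injective (α := V)
      (β := {v : V // (G.neighborSet v).ncard = 2} × {i : Fin n // (i : ℕ) ≠ 0}))]
    congr 1
    ext y
    rcases y with b | ⟨v, j⟩
    · simp [addCycles_adj_inl_inl]
    · simp only [Set.mem_sdiff, SimpleGraph.mem_neighborSet, Set.mem_image, Set.mem_prod,
        Set.mem_singleton_iff, Set.mem_univ, and_true, Sum.inr.injEq, exists_eq_right,
        (addCycles G n).adj_comm (Sum.inl a), addCycles_adj_inr, addedCycleVertex_eq_inl,
        reduceCtorEq, and_false, exists_false, iff_false, not_and, not_not]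
      rintro ⟨i, -, -, h⟩
      exact Subtype.ext h
  even := by
    convert even_ncard_image_inr hn {⟨a, ha⟩} using 2
    ext y
    simp only [Set.mem_ofPred_eq, and_iff_left_iff_imp]
    rintro ⟨q, -, rfl⟩
    exact ncard_neighborSet_addCycles_inr hn3 q

theorem neighborSet_addCycles_inl {V : Type*} {G : SimpleGraph V} {n : ℕ}
    {a : V} (ha : (G.neighborSet a).ncard ≠ 2) :
    (addCycles G n).neighborSet (Sum.inl a) = Sum.inl '' G.neighborSet a := by
  ext y
  rcases y with b | ⟨v, j⟩
  · simp [addCycles_adj_inl_inl]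
  · simp only [SimpleGraph.mem_neighborSet, (addCycles G n).adj_comm (Sum.inl a),
      addCycles_adj_inr, addedCycleVertex_eq_inl, Set.mem_image, reduceCtorEq, and_false,
      exists_false, iff_false, not_exists, not_and]
    rintro i - - rfl
    exact ha v.2

theorem HasOddSeparations.ncard_neighborSet_addCycles_inl {V : Type*} {G : SimpleGraph V} {n : ℕ}
    (h : HasOddSeparations G) (hn : Odd n) (hn3 : 3 ≤ n) (a : V) :
    ((addCycles G n).neighborSet (Sum.inl a)).ncard = 4 := by
  by_cases ha : (G.neighborSet a).ncard = 2
  · exact (isOddSeparation_addedCycle hn hn3 ha).ncard_neighborSet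
  · rw [neighborSet_addCycles_inl ha, Set.ncard_image_of_injective _ Sum.inl_injective]
    exact (h.ncard_neighborSet a).resolve_left ha

/-- The added cycle is one side of an odd separation at a vertex that had degree two. At the other
old vertices, the side `T` of an odd separation of `G` is enlarged by the cycles added at `T`. -/
theorem HasOddSeparations.addCycles {V : Type*} {G : SimpleGraph V} {n : ℕ}
    (h : HasOddSeparations G) (hn : Odd n) (hn3 : 3 ≤ n) : HasOddSeparations (addCycles G n) := by
  rintro (a | q)
  swap
  · exact Or.inl (ncard_neighborSet_addCycles_inr hn3 q)
  rcases h a with ha | ⟨T, hT⟩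
  · exact Or.inr ⟨_, isOddSeparation_addedCycle hn hn3 ha⟩
  have ha : (G.neighborSet a).ncard ≠ 2 := by rw [hT.ncard_neighborSet]; norm_num
  have hinter : ∀ B C, (Sum.inl '' G.neighborSet a : Set (AddCyclesVertex G n)) ∩
      (Sum.inl '' B ∪ Sum.inr '' C) = Sum.inl '' (G.neighborSet a ∩ B) := by
    intro B C
    ext y
    rcases y with y | y <;> simp
  have hdiff : ∀ B C, (Sum.inl '' G.neighborSet a : Set (AddCyclesVertex G n)) \
      (Sum.inl '' B ∪ Sum.inr '' C) = Sum.inl '' (G.neighborSet a \ B) := by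
    intro B C
    ext y
    rcases y with y | y <;> simp
  refine Or.inr ⟨Sum.inl '' T ∪ Sum.inr '' ({v | v.1 ∈ T} ×ˢ Set.univ), ?_, ?_, ?_, ?_, ?_⟩
  · simpa using hT.notMem
  · have hmem : ∀ v, v.1 ∈ T → ∀ i, addedCycleVertex G n v i ∈
        (Sum.inl '' T ∪ Sum.inr '' ({v | v.1 ∈ T} ×ˢ Set.univ) : Set (AddCyclesVertex G n)) := by
      intro v hv i
      unfold addedCycleVertex
      split_ifs <;> simp [hv]
    rintro (b | ⟨v, j⟩) hb y hy
    · have hb' : b ∈ T := by simpa using hb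
      rcases addCycles_adj.1 hy with ⟨b', c, hbc, e, rfl⟩ | ⟨v, i, j, -, e, rfl⟩
      · obtain rfl := Sum.inl_injective e
        simpa using hT.closed _ hb' c hbc
      · rw [addedCycleVertex_eq_inl] at e
        exact Or.inl (hmem v (e.2 ▸ hb') j)
    · have hv : v.1 ∈ T := by simpa using hb
      obtain ⟨i, -, rfl⟩ := addCycles_adj_inr.1 hy
      exact Or.inl (hmem v hv i)
  · rw [neighborSet_addCycles_inl ha, hinter, Set.ncard_image_of_injective _ Sum.inl_injective,
      hT.inside]
  · rw [neighborSet_addCycles_inl ha, hdiff, Set.ncard_image_of_injective _ Sum.inl_injective,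
      hT.outside]
  · convert even_ncard_image_inr hn {v | v.1 ∈ T} using 2
    ext y
    rcases y with b | q
    · simp [h.ncard_neighborSet_addCycles_inl hn hn3]
    · simp only [Set.mem_ofPred_eq, ncard_neighborSet_addCycles_inr hn3, and_true, Set.mem_union,
        Set.mem_image, reduceCtorEq, and_false, exists_false, false_or]

/-- The vertices of degree two are the new ones. -/
theorem HasOddSeparations.even_ncard_addCycles {V : Type*} {G : SimpleGraph V} {n : ℕ}
    (h : HasOddSeparations G) (hn : Odd n) (hn3 : 3 ≤ n) :
    Even {v | ((_root_.addCycles G n).neighborSet v).ncard = 2}.ncard := by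
  convert even_ncard_image_inr hn Set.univ using 2
  ext y
  rcases y with b | q
  · simp [h.ncard_neighborSet_addCycles_inl hn hn3]
  · simp [ncard_neighborSet_addCycles_inr hn3]

theorem hasOddSeparations_cycleTree {n : ℕ} (hn : Odd n) (hn3 : 3 ≤ n) (r : ℕ) :
    HasOddSeparations (cycleTree n r) := by
  induction r with
  | zero => exact fun i => Or.inl (ncard_neighborSet_cycleGraph hn3 i)
  | succ r ih => exact ih.addCycles hn hn3

theorem finite_cycleTreeVertex (n r : ℕ) : Finite (CycleTreeVertex n r) := by
  induction r with
  | zero => exact inferInstanceAs (Finite (Fin n))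
  | succ r ih => exact inferInstanceAs (Finite (AddCyclesVertex (cycleTree n r) n))

/-! ### Subdivisions -/

section subdivision

variable {V : Type*} {G : SimpleGraph V} {k : ℕ}

theorem out_fst_ne_out_snd (e : G.edgeSet) : (Quot.out e.1).1 ≠ (Quot.out e.1).2 := by
  have h := e.2
  rw [← Quot.out_eq e.1] at h
  exact G.ne_of_adj h

theorem subdivisionPath_injective (e : G.edgeSet) :
    Function.Injective (subdivisionPath G k e) := by
  intro i j h
  unfold subdivisionPath at h
  split_ifs at h with h1 h2 h3 h4 h5 h6 <;>
    simp only [Sum.inl.injEq, Sum.inr.injEq, Prod.mk.injEq, Fin.mk.injEq, true_and] at h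
  · exact Fin.ext (h1.trans h2.symm)
  · exact absurd h (out_fst_ne_out_snd e)
  · exact absurd h.symm (out_fst_ne_out_snd e)
  · exact Fin.ext (by omega)
  · exact Fin.ext (by omega)

theorem subdivision_adj {x y : SubdivisionVertex G k} :
    (subdivision G k).Adj x y ↔ ∃ e i j, (SimpleGraph.pathGraph (k + 1)).Adj i j ∧
      subdivisionPath G k e i = x ∧ subdivisionPath G k e j = y := by
  rw [subdivision, SimpleGraph.iSup_adj]
  refine exists_congr fun e => ?_
  exact SimpleGraph.map_adj ⟨_, subdivisionPath_injective e⟩ _ x y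

theorem subdivisionPath_eq_inr {e e' : G.edgeSet} {i : Fin (k + 1)} {m : Fin (k - 1)} :
    subdivisionPath G k e i = Sum.inr (e', m) ↔ e = e' ∧ (i : ℕ) = m + 1 := by
  unfold subdivisionPath
  split_ifs with h1 h2
  · simp [h1]
  · simp only [false_iff, not_and]
    omega
  · simp only [Sum.inr.injEq, Prod.mk.injEq, Fin.ext_iff]
    refine and_congr_right fun _ => ?_
    omega

theorem subdivisionPath_eq_inl {e : G.edgeSet} {i : Fin (k + 1)} {v : V} :
    subdivisionPath G k e i = Sum.inl v ↔
      ((i : ℕ) = 0 ∧ (Quot.out e.1).1 = v) ∨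
        ((i : ℕ) ≠ 0 ∧ (i : ℕ) = k ∧ (Quot.out e.1).2 = v) := by
  unfold subdivisionPath
  split_ifs with h1 h2 <;> simp [h1] <;> omega

theorem mem_iff_out_eq {e : Sym2 V} {v : V} :
    v ∈ e ↔ (Quot.out e).1 = v ∨ (Quot.out e).2 = v := by
  conv_lhs => rw [← Quot.out_eq e]
  exact Sym2.mem_iff.trans (or_congr eq_comm eq_comm)

theorem mem_edge_of_subdivisionPath {e : G.edgeSet} {i : Fin (k + 1)} {v : V}
    (h : subdivisionPath G k e i = Sum.inl v) : v ∈ e.1 :=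
  mem_iff_out_eq.2 <| (subdivisionPath_eq_inl.1 h).imp (fun h => h.2) fun h => h.2.2

theorem ncard_neighborSet_subdivision_inr (q : G.edgeSet × Fin (k - 1)) :
    ((subdivision G k).neighborSet (Sum.inr q)).ncard = 2 := by
  obtain ⟨e, m⟩ := q
  have hm := m.2
  have : (subdivision G k).neighborSet (Sum.inr (e, m)) =
      subdivisionPath G k e '' {⟨m, by omega⟩, ⟨m + 2, by omega⟩} := by
    ext y
    simp only [SimpleGraph.mem_neighborSet, subdivision_adj, subdivisionPath_eq_inr,
      SimpleGraph.pathGraph_adj, Set.mem_image, Set.mem_insert_iff, Set.mem_singleton_iff,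
      Fin.ext_iff]
    constructor
    · rintro ⟨_, i, j, hij, ⟨rfl, hi⟩, rfl⟩
      exact ⟨j, by omega, rfl⟩
    · rintro ⟨j, hj, rfl⟩
      exact ⟨e, ⟨m + 1, by omega⟩, j, by simp only; omega, ⟨rfl, rfl⟩, rfl⟩
  rw [this, Set.ncard_image_of_injective _ (subdivisionPath_injective e), Set.ncard_pair]
  simp

/-- The first vertex after `v` on the path that replaces an edge `e` at `v`. -/
noncomputable def firstVertex (hk : 2 ≤ k) (v : V) (e : G.edgeSet) : SubdivisionVertex G k :=
  open Classical in
  Sum.inr (e, if (Quot.out e.1).1 = v then ⟨0, by omega⟩ else ⟨k - 2, by omega⟩)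

theorem firstVertex_injective (hk : 2 ≤ k) (v : V) :
    Function.Injective (firstVertex (G := G) hk v) := fun _ _ h =>
  (Prod.ext_iff.1 (Sum.inr_injective h)).1

theorem neighborSet_subdivision_inl (hk : 2 ≤ k) (v : V) :
    (subdivision G k).neighborSet (Sum.inl v) = firstVertex hk v '' {e | v ∈ e.1} := by
  ext y
  simp only [SimpleGraph.mem_neighborSet, subdivision_adj, subdivisionPath_eq_inl,
    SimpleGraph.pathGraph_adj, Set.mem_image, Set.mem_ofPred_eq, mem_iff_out_eq]
  constructor
  · rintro ⟨e, i, j, hij, ⟨hi, hv⟩ | ⟨hi, hik, hv⟩, rfl⟩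
    · refine ⟨e, Or.inl hv, ?_⟩
      rw [firstVertex, if_pos hv, eq_comm, subdivisionPath_eq_inr]
      exact ⟨rfl, by simp only; omega⟩
    · refine ⟨e, Or.inr hv, ?_⟩
      rw [firstVertex, if_neg fun h => out_fst_ne_out_snd e (h.trans hv.symm), eq_comm,
        subdivisionPath_eq_inr]
      have := j.2
      exact ⟨rfl, by simp only; omega⟩
  · rintro ⟨e, he, rfl⟩
    by_cases hv : (Quot.out e.1).1 = v
    · refine ⟨e, ⟨0, by omega⟩, ⟨1, by omega⟩, by simp, Or.inl ⟨rfl, hv⟩, ?_⟩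
      rw [firstVertex, if_pos hv, subdivisionPath_eq_inr]
      exact ⟨rfl, rfl⟩
    · refine ⟨e, ⟨k, by omega⟩, ⟨k - 1, by omega⟩, by simp only; omega,
        Or.inr ⟨by simp only; omega, rfl, he.resolve_left hv⟩, ?_⟩
      rw [firstVertex, if_neg hv, subdivisionPath_eq_inr]
      exact ⟨rfl, by simp only; omega⟩

theorem ncard_edges_at (p : V) (B : Set V) :
    {e : G.edgeSet | ∃ b ∈ B, e.1 = s(p, b)}.ncard = (G.neighborSet p ∩ B).ncard := by
  rw [← Set.ncard_image_of_injective _ Subtype.val_injective,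
    ← Set.ncard_image_of_injective (G.neighborSet p ∩ B) (f := fun b => s(p, b))
      fun b c h => Sym2.congr_right.1 h]
  congr 1
  ext e
  simp only [Set.mem_image, Set.mem_ofPred_eq, Subtype.exists, exists_and_right, exists_eq_right,
    Set.mem_inter_iff, SimpleGraph.mem_neighborSet]
  constructor
  · rintro ⟨he, b, hb, rfl⟩
    exact ⟨b, ⟨he, hb⟩, rfl⟩
  · rintro ⟨b, ⟨he, hb⟩, rfl⟩
    exact ⟨he, b, hb, rfl⟩

theorem ncard_neighborSet_subdivision_inl (hk : 2 ≤ k) (v : V) :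
    ((subdivision G k).neighborSet (Sum.inl v)).ncard = (G.neighborSet v).ncard := by
  rw [neighborSet_subdivision_inl hk, Set.ncard_image_of_injective _ (firstVertex_injective hk v),
    ← Set.inter_univ (G.neighborSet v), ← ncard_edges_at]
  simp only [Set.mem_univ, true_and, Sym2.mem_iff_exists]

/-- For odd `k`, an even number of new vertices lies on each path. -/
theorem even_ncard_subdivision [Finite V] (hk : 2 ≤ k) (hodd : Odd k) {T : Set V}
    (hT : Even {v | v ∈ T ∧ (G.neighborSet v).ncard = 2}.ncard) (S : Set G.edgeSet) :
    Even {v | v ∈ (Sum.inl '' T ∪ Sum.inr '' (S ×ˢ Set.univ) : Set (SubdivisionVertex G k)) ∧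
      ((subdivision G k).neighborSet v).ncard = 2}.ncard := by
  have : {v | v ∈ (Sum.inl '' T ∪ Sum.inr '' (S ×ˢ Set.univ) : Set (SubdivisionVertex G k)) ∧
      ((subdivision G k).neighborSet v).ncard = 2} =
      Sum.inl '' {v | v ∈ T ∧ (G.neighborSet v).ncard = 2} ∪ Sum.inr '' (S ×ˢ Set.univ) := by
    ext y
    rcases y with b | q
    · simp [ncard_neighborSet_subdivision_inl hk]
    · simp only [Set.mem_ofPred_eq, ncard_neighborSet_subdivision_inr, and_true, Set.mem_union,
        Set.mem_image, reduceCtorEq, and_false, exists_false, false_or]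
  rw [this, Set.ncard_union_eq
    (Set.disjoint_image_inl_image_inr) (Set.toFinite _) (Set.toFinite _),
    Set.ncard_image_of_injective _ Sum.inl_injective,
    Set.ncard_image_of_injective _ Sum.inr_injective, Set.ncard_prod, Set.ncard_univ,
    Nat.card_eq_fintype_card, Fintype.card_fin]
  exact hT.add ((Nat.Odd.sub_odd hodd odd_one).mul_left _)

/-- The vertex `p` of `G` keeps its odd separation, the side `T` being enlarged by the interiors of
the paths that replace the edges with an end in `T`. -/
theorem HasOddSeparations.subdivision [Finite V] (h : HasOddSeparations G) (hk : 2 ≤ k)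
    (hodd : Odd k) : HasOddSeparations (subdivision G k) := by
  rintro (p | q)
  swap
  · exact Or.inl (ncard_neighborSet_subdivision_inr q)
  rcases h p with hp | ⟨T, hT⟩
  · exact Or.inl ((ncard_neighborSet_subdivision_inl hk p).trans hp)
  let S : Set G.edgeSet := {e | ∃ a ∈ T, a ∈ e.1}
  have hends : ∀ e ∈ S, ∀ b ∈ e.1, b ∈ T ∨ b = p := by
    rintro ⟨e, he⟩ ⟨a, ha, hae⟩ b hb
    obtain ⟨c, rfl⟩ := Sym2.mem_iff_exists.1 hae
    rcases Sym2.mem_iff.1 hb with rfl | rfl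
    · exact Or.inl ha
    · exact hT.closed a ha _ he
  have hin : ∀ e, p ∈ e.1 ∧ e ∈ S ↔ ∃ b ∈ T, e.1 = s(p, b) := by
    intro e
    constructor
    · rintro ⟨hp, a, ha, hae⟩
      have hpa : p ≠ a := fun h => hT.notMem (h ▸ ha)
      exact ⟨a, ha, (Sym2.mem_and_mem_iff hpa).1 ⟨hp, hae⟩⟩
    · rintro ⟨b, hb, he⟩
      exact ⟨by simp [he], b, hb, by simp [he]⟩
  have hout : ∀ e, p ∈ e.1 ∧ e ∉ S ↔ ∃ b ∈ Tᶜ, e.1 = s(p, b) := by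
    intro e
    constructor
    · rintro ⟨hp, hS⟩
      obtain ⟨b, hb⟩ := Sym2.mem_iff_exists.1 hp
      exact ⟨b, fun hbT => hS ⟨b, hbT, by simp [hb]⟩, hb⟩
    · rintro ⟨b, hb, he⟩
      refine ⟨by simp [he], ?_⟩
      rintro ⟨a, ha, hae⟩
      rw [he, Sym2.mem_iff] at hae
      rcases hae with rfl | rfl
      · exact hT.notMem ha
      · exact hb ha
  have hfirst : ∀ e, firstVertex hk p e ∈
      (Sum.inl '' T ∪ Sum.inr '' (S ×ˢ Set.univ) : Set (SubdivisionVertex G k)) ↔ e ∈ S := by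
    intro e
    simp [firstVertex]
  refine Or.inr ⟨Sum.inl '' T ∪ Sum.inr '' (S ×ˢ Set.univ), ?_, ?_, ?_, ?_, ?_⟩
  · simpa using hT.notMem
  · intro x hx y hxy
    obtain ⟨e, i, j, -, rfl, rfl⟩ := subdivision_adj.1 hxy
    have he : e ∈ S := by
      rcases hx with ⟨a, ha, hx⟩ | ⟨⟨e', m⟩, ⟨he', -⟩, hx⟩
      · exact ⟨a, ha, mem_edge_of_subdivisionPath hx.symm⟩
      · rw [(subdivisionPath_eq_inr.1 hx.symm).1]
        exact he'
    rcases hy : subdivisionPath G k e j with b | ⟨e', m⟩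
    · simpa using hends e he b (mem_edge_of_subdivisionPath hy)
    · obtain rfl := (subdivisionPath_eq_inr.1 hy).1
      exact Or.inl (Or.inr ⟨_, ⟨he, trivial⟩, rfl⟩)
  · rw [neighborSet_subdivision_inl hk, ← hT.inside, ← ncard_edges_at,
      ← Set.ncard_image_of_injective _ (firstVertex_injective hk p)]
    congr 1
    ext y
    constructor
    · rintro ⟨⟨e, he, rfl⟩, hy⟩
      exact ⟨e, (hin e).1 ⟨he, (hfirst e).1 hy⟩, rfl⟩
    · rintro ⟨e, he, rfl⟩
      exact ⟨⟨e, ((hin e).2 he).1, rfl⟩, (hfirst e).2 ((hin e).2 he).2⟩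
  · rw [neighborSet_subdivision_inl hk, ← hT.outside, Set.sdiff_eq (G.neighborSet p),
      ← ncard_edges_at, ← Set.ncard_image_of_injective _ (firstVertex_injective hk p)]
    congr 1
    ext y
    constructor
    · rintro ⟨⟨e, he, rfl⟩, hy⟩
      exact ⟨e, (hout e).1 ⟨he, fun h => hy ((hfirst e).2 h)⟩, rfl⟩
    · rintro ⟨e, he, rfl⟩
      exact ⟨⟨e, ((hout e).2 he).1, rfl⟩, fun h => ((hout e).2 he).2 ((hfirst e).1 h)⟩
  · exact even_ncard_subdivision hk hodd hT.even S

end subdivision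

theorem proposition3p8 (K : Type*) [Field K] (n r k : ℕ)
    (hn : Odd n) (hn3 : 3 ≤ n) (hr : 1 ≤ r) (hk : Odd k) (hk3 : 3 ≤ k)
    [DecidableEq (SubdivisionVertex (cycleTree n r) k)]
    (x : SubdivisionVertex (cycleTree n r) k)
    (w : (subdivision (cycleTree n r) k).Walk x x) (hw : w.IsEulerian) :
    Even w.length ∧
      walkBinomial K w ∈ graverBasis K (edgeVector (subdivision (cycleTree n r) k)) := by
  have hfin := finite_cycleTreeVertex n r
  have hk2 : 2 ≤ k := by omega
  have hsep := hasOddSeparations_cycleTree hn hn3 r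
  have hdeg : Even {v | ((cycleTree n r).neighborSet v).ncard = 2}.ncard := by
    obtain ⟨r, rfl⟩ := Nat.exists_eq_add_of_le' hr
    exact (hasOddSeparations_cycleTree hn hn3 r).even_ncard_addCycles hn hn3
  have hsub := hsep.subdivision hk2 hk
  have heven : Even {v | ((subdivision (cycleTree n r) k).neighborSet v).ncard = 2}.ncard := by
    have := even_ncard_subdivision hk2 hk (T := Set.univ) (by simpa using hdeg) Set.univ
    convert this using 3
    ext v
    rcases v with v | v <;> simp
  exact ⟨hsub.even_length heven hw, hsub.walkBinomial_mem_graverBasis K heven hw⟩
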